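/- Let $\mathcal H$ be a complex Hilbert space and let $M$ be a (possibly unbounded) self-adjoint operator in $\mathcal H$. Let $(\mathcal L_n)$ be a sequence of finite-dimensional subspaces with $\mathcal L_n\subset \mathrm{Dom}\,M^2$ (not necessarily nested), and let $P_n$ be the orthogonal projection of $\mathcal H$ onto $\mathcal L_n$; assume that $P_nx\to x$ for every $x\in\mathcal H$. The second order spectrum of $M$ relative to $\mathcal L_n$ is $$\mathrm{Spec}_2(M|\mathcal L_n)=\{z\in\mathbb C:\ \det[P_n(M-z)^2|_{\mathcal L_n}]=0\}.$$ Let $\lambda$ be an eigenvalue of $M$ of finite multiplicity which is an isolated point of the spectrum of $M$, and assume (H) for every $\psi\in\mathrm{Dom}\,M$ with $M\psi=\lambda\psi$: $\ \|P_nMP_n\psi-\lambda\psi\|\to0$ and $\|P_nM^2P_n\psi-\lambda^2\psi\|\to0$ as $n\to\infty$. Then $\lambda$ belongs to the uniform limiting set $\Lambda$ of the sets $\mathrm{Spec}_2(M|\mathcal L_n)$, that is, the set of all limits $\lim_{n\to\infty} z_n$ of sequences with $z_n\in\mathrm{Spec}_2(M|\mathcal L_n)$ for all sufficiently large $n$.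 In other words, there are $z_n$ with $z_n\in\mathrm{Spec}_2(M|\mathcal L_n)$ for all large $n$ and $z_n\to\lambda$. -/

import Mathlib

open Filter Topology

namespace SecondOrder

noncomputable section

variable {H : Type*} [NormedAddCommGroup H] [InnerProductSpace ℂ H]

/-- The operator `T - z`, with the same domain as `T`. -/
def shift (T : H →ₗ.[ℂ] H) (z : ℂ) : H →ₗ.[ℂ] H where
  domain := T.domain
  toFun := T.toFun - z • T.domain.subtype

/-- The square `T²` of an unbounded operator, on its natural domain
`{x ∈ Dom T | T x ∈ Dom T}`. -/
def sq (T : H →ₗ.[ℂ] H) : H →ₗ.[ℂ] H where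
  domain :=
    { carrier := {x | ∃ h : x ∈ T.domain, T ⟨x, h⟩ ∈ T.domain}
      zero_mem' := ⟨T.domain.zero_mem, by
        have : T ⟨0, T.domain.zero_mem⟩ = 0 := T.map_zero
        rw [this]; exact T.domain.zero_mem⟩
      add_mem' := by
        rintro x y ⟨hx, hx'⟩ ⟨hy, hy'⟩
        refine ⟨T.domain.add_mem hx hy, ?_⟩
        have : T ⟨x + y, T.domain.add_mem hx hy⟩ = T ⟨x, hx⟩ + T ⟨y, hy⟩ :=
          T.map_add ⟨x, hx⟩ ⟨y, hy⟩
        rw [this]; exact T.domain.add_mem hx' hy'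
      smul_mem' := by
        rintro c x ⟨hx, hx'⟩
        refine ⟨T.domain.smul_mem c hx, ?_⟩
        have : T ⟨c • x, T.domain.smul_mem c hx⟩ = c • T ⟨x, hx⟩ :=
          T.map_smul c ⟨x, hx⟩
        rw [this]; exact T.domain.smul_mem c hx' }
  toFun :=
    { toFun := fun x => T ⟨T ⟨x.1, x.2.1⟩, x.2.2⟩
      map_add' := fun x y => by
        rw [← T.map_add]
        congr 1
        exact Subtype.ext (T.map_add ⟨x.1, x.2.1⟩ ⟨y.1, y.2.1⟩)
      map_smul' := fun c x => by
        rw [RingHom.id_apply, ← T.map_smul]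
        congr 1
        exact Subtype.ext (T.map_smul c ⟨x.1, x.2.1⟩) }

theorem sq_domain_le (T : H →ₗ.[ℂ] H) : (sq T).domain ≤ T.domain :=
  fun _ hx => hx.1

/-- `Dom (T - z)²` contains `Dom T²` (they are in fact equal). -/
theorem sq_domain_le_sq_shift_domain (T : H →ₗ.[ℂ] H) (z : ℂ) :
    (sq T).domain ≤ (sq (shift T z)).domain :=
  fun _ hx => ⟨hx.1, T.domain.sub_mem hx.2 (T.domain.smul_mem z hx.1)⟩

/-- The spectrum of a (possibly unbounded) operator: the complement of the set of those `z` for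
which `T - z : Dom T → H` has a bounded everywhere defined two-sided inverse. -/
def spec (T : H →ₗ.[ℂ] H) : Set ℂ :=
  {z | ∃ R : H →L[ℂ] H,
    (∀ y : H, ∃ h : R y ∈ (shift T z).domain, shift T z ⟨R y, h⟩ = y) ∧
    ∀ x : (shift T z).domain, R (shift T z x) = x}ᶜ

/-- The eigenspace `{ψ ∈ Dom T | T ψ = lam ψ}`. -/
def eigenspace (T : H →ₗ.[ℂ] H) (lam : ℂ) : Submodule ℂ H :=
  (LinearMap.ker (shift T lam).toFun).map (shift T lam).domain.subtype

/-- `lam` is an eigenvalue of `T` of finite multiplicity and an isolated point of the spectrum. -/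
structure IsIsolatedEigenvalueFiniteMult (T : H →ₗ.[ℂ] H) (lam : ℂ) : Prop where
  eigenvalue : eigenspace T lam ≠ ⊥
  finite_mult : FiniteDimensional ℂ (eigenspace T lam)
  isolated : ∀ᶠ w in 𝓝[≠] lam, w ∉ spec T

/-- The truncation `P T|L : L → L`, where `P` is the orthogonal projection onto `L ⊆ Dom T`. -/
def truncation (T : H →ₗ.[ℂ] H) (L : Submodule ℂ H) [L.HasOrthogonalProjection]
    (hL : L ≤ T.domain) : L →ₗ[ℂ] L :=
  L.orthogonalProjectionOnto.toLinearMap ∘ₗ T.toFun ∘ₗ Submodule.inclusion hL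

/-- The second order spectrum of `M` relative to a finite-dimensional `L ⊆ Dom M²`:
the set of `z` with `det (P (M - z)²|L) = 0`. -/
def spec₂ (M : H →ₗ.[ℂ] H) (L : Submodule ℂ H) [FiniteDimensional ℂ L]
    (hL : L ≤ (sq M).domain) : Set ℂ :=
  {z | LinearMap.det
    (truncation (sq (shift M z)) L (hL.trans (sq_domain_le_sq_shift_domain M z))) = 0}

/-- The uniform limiting set of a sequence of subsets of `ℂ`: all limits of sequences whose
`n`-th term lies in the `n`-th set for all large `n`. -/
def uniformLimit (S : ℕ → Set ℂ) : Set ℂ :=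
  {z | ∃ w : ℕ → ℂ, (∀ᶠ n in atTop, w n ∈ S n) ∧ Tendsto w atTop (𝓝 z)}

/-- Condition (H): `P_n M P_n ψ → lam ψ` and `P_n M² P_n ψ → lam² ψ` for every `ψ` with
`M ψ = lam ψ`. -/
def ConditionH (M : H →ₗ.[ℂ] H) (lam : ℂ) (L : ℕ → Submodule ℂ H)
    [∀ n, FiniteDimensional ℂ (L n)] (hL : ∀ n, L n ≤ (sq M).domain) : Prop :=
  ∀ ψ ∈ eigenspace M lam,
    Tendsto (fun n => (truncation M (L n) ((hL n).trans (sq_domain_le M))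
      ((L n).orthogonalProjectionOnto ψ) : H)) atTop (𝓝 (lam • ψ)) ∧
    Tendsto (fun n => (truncation (sq M) (L n) (hL n)
      ((L n).orthogonalProjectionOnto ψ) : H)) atTop (𝓝 (lam ^ 2 • ψ))

end

end SecondOrder

/-!
Self-adjointness and the isolation of `lam` give a gap: `‖v‖ ≤ C ‖(M - lam) v‖` for `v ∈ Dom M`
orthogonal to the eigenspace. Let `B z = P (M - z)²|L`, so that the adjoint of `B z` is
`B (conj z)`, and let `r` be small. On the circle `|z - lam| = r` the operator `B z` is bounded
below by `r² / 4`. A vector close to the eigenspace is tested against `P φ`, where `φ` is its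
spectral projection, because (H) says that `B (conj z) P φ ≈ (lam - conj z)² φ`. For a vector far
from the eigenspace the gap makes `⟪B z v, v⟫ ≈ ‖(M - lam) v‖²` large. If `spec₂` missed the disc
`|z - lam| ≤ r`, then `(B z)⁻¹` would be holomorphic on it and the maximum principle would carry the
lower bound to its centre, where (H) gives `B lam P ψ ≈ 0` for an eigenvector `ψ`.
-/

namespace SecondOrder

section NormalOperator

variable {H : Type*} [NormedAddCommGroup H] [InnerProductSpace ℂ H] [CompleteSpace H]

-- The continuous functional calculus is applied to `t ↦ (t - z)⁻¹`, continuous on the spectrum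
-- because `z` is isolated; it is only a generalized inverse because of the junk value `0⁻¹ = 0`.
theorem exists_commute_mul_mul_eq_of_isolated {A : Type*} [CStarAlgebra A] {a : A} [IsStarNormal a]
    {z : ℂ} (hz : ∀ᶠ w in 𝓝[≠] z, w ∉ spectrum ℂ a) :
    ∃ g, Commute g (a - z • 1) ∧ (a - z • 1) * g * (a - z • 1) = a - z • 1 := by
  have hinv : ContinuousOn (fun t : ℂ => (t - z)⁻¹) (spectrum ℂ a) := by
    intro t _
    rcases eq_or_ne t z with rfl | hne
    · exact continuousWithinAt_of_not_accPt fun hacc => accPt_iff_frequently_nhdsNE.1 hacc hz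
    · exact ContinuousWithinAt.inv₀ (by fun_prop) (sub_ne_zero.2 hne)
  have hsub : cfc (fun t : ℂ => t - z) a = a - z • 1 := by
    rw [cfc_sub .., cfc_id' ℂ a, cfc_const z a, Algebra.algebraMap_eq_smul_one]
  rw [← hsub]
  refine ⟨cfc (fun t : ℂ => (t - z)⁻¹) a, cfc_commute_cfc _ _ a, ?_⟩
  rw [← cfc_mul .., ← cfc_mul ..]
  simp only [mul_inv_mul_cancel]

theorem apply_apply_eq_of_mem_orthogonal_ker {S G : H →L[ℂ] H} (hS : IsStarNormal S)
    (hcomm : Commute G S) (hinv : S * G * S = S) {v : H} (hv : v ∈ S.kerᗮ) : G (S v) = v := by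
  have hker : G (S v) - v ∈ S.ker := by
    rw [LinearMap.mem_ker, map_sub, sub_eq_zero]
    exact congr($hinv v)
  have hrange : G (S v) ∈ S.kerᗮ := by
    rw [← ContinuousLinearMap.IsStarNormal.orthogonal_range hS]
    exact Submodule.le_orthogonal_orthogonal _ ⟨G v, congr($(hcomm.eq.symm) v)⟩
  exact sub_eq_zero.1 <| Submodule.disjoint_def.1 S.ker.orthogonal_disjoint _ hker
    (Submodule.sub_mem _ hrange hv)

theorem exists_norm_le_mul_norm_sub_smul_of_isolated {T : H →L[ℂ] H} [IsStarNormal T] {z : ℂ}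
    (hz : ∀ᶠ w in 𝓝[≠] z, w ∉ spectrum ℂ T) :
    ∃ C : ℝ, 0 ≤ C ∧ ∀ v ∈ (Module.End.eigenspace (T : H →ₗ[ℂ] H) z)ᗮ,
      ‖v‖ ≤ C * ‖T v - z • v‖ := by
  obtain ⟨G, hcomm, hinv⟩ := exists_commute_mul_mul_eq_of_isolated hz
  have hnormal : IsStarNormal (T - z • (1 : H →L[ℂ] H)) := by
    refine Commute.isStarNormal_sub ?_
    rw [star_smul, star_one]
    exact (Commute.one_right T).smul_right _
  refine ⟨‖G‖, norm_nonneg G, fun v hv => ?_⟩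
  have hmem : v ∈ (T - z • (1 : H →L[ℂ] H)).kerᗮ := fun u hu =>
    hv u <| Module.End.mem_eigenspace_iff.2 <| sub_eq_zero.1 hu
  calc ‖v‖ = ‖G (T v - z • v)‖ :=
        congrArg norm (apply_apply_eq_of_mem_orthogonal_ker hnormal hcomm hinv hmem).symm
    _ ≤ ‖G‖ * ‖T v - z • v‖ := G.le_opNorm _

end NormalOperator

theorem mul_norm_le_norm_apply_of_forall_frontier {V : Type*} [NormedAddCommGroup V]
    [NormedSpace ℂ V] [CompleteSpace V] {A : ℂ → V →L[ℂ] V} {U : Set ℂ}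
    (hU : Bornology.IsBounded U) (hA : DiffContOnCl ℂ A U) (hunit : ∀ z ∈ closure U, IsUnit (A z))
    {c : ℝ} (hc : 0 < c) (hbound : ∀ z ∈ frontier U, ∀ v, c * ‖v‖ ≤ ‖A z v‖) {a : ℂ}
    (ha : a ∈ closure U) (v : V) : c * ‖v‖ ≤ ‖A a v‖ := by
  have hinv : ∀ z ∈ closure U, DifferentiableAt ℂ Ring.inverse (A z) := fun z hz =>
    differentiableAt_inverse (hunit z hz)
  -- The maximum principle is applied to `z ↦ (A z)⁻¹ (A a v)`, whose value at `a` is `v`.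
  have hdiff : DiffContOnCl ℂ (fun z => Ring.inverse (A z) (A a v)) U :=
    ⟨fun z hz => ((hinv z (subset_closure hz)).comp_differentiableWithinAt z
        (hA.differentiableOn z hz)).clm_apply (differentiableWithinAt_const _),
      fun z hz => ((hinv z hz).continuousAt.comp_continuousWithinAt
        (hA.continuousOn z hz)).clm_apply continuousWithinAt_const⟩
  have hfrontier : ∀ z ∈ frontier U, ‖Ring.inverse (A z) (A a v)‖ ≤ ‖A a v‖ / c := by
    intro z hz
    have hcancel : A z (Ring.inverse (A z) (A a v)) = A a v :=
      congr($(Ring.mul_inverse_cancel _ (hunit z (frontier_subset_closure hz))) (A a v))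
    rw [le_div_iff₀' hc]
    exact (hbound z hz _).trans_eq (congrArg norm hcancel)
  have hcancel : Ring.inverse (A a) (A a v) = v :=
    congr($(Ring.inverse_mul_cancel _ (hunit a ha)) v)
  have hmax := Complex.norm_le_of_forall_mem_frontier_norm_le hU hdiff hfrontier ha
  rwa [hcancel, le_div_iff₀' hc] at hmax

theorem differentiable_quadratic {𝕜 V : Type*} [NontriviallyNormedField 𝕜] [NormedAddCommGroup V]
    [NormedSpace 𝕜 V] (a b c : V) :
    Differentiable 𝕜 fun z : 𝕜 => a - (2 * z) • b + z ^ 2 • c := by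
  fun_prop

theorem eventually_forall_norm_sub_le_of_tendsto {𝕜 ι E F : Type*} [NontriviallyNormedField 𝕜]
    [CompleteSpace 𝕜] [NormedAddCommGroup E] [NormedSpace 𝕜 E] [NormedAddCommGroup F]
    [NormedSpace 𝕜 F] {l : Filter ι} {T : ι → E →ₗ[𝕜] F} {T₀ : E →ₗ[𝕜] F} (K : Submodule 𝕜 E)
    [FiniteDimensional 𝕜 K] (hT : ∀ x ∈ K, Tendsto (fun n => T n x) l (𝓝 (T₀ x))) {ε : ℝ}
    (hε : 0 < ε) : ∀ᶠ n in l, ∀ x ∈ K, ‖T n x - T₀ x‖ ≤ ε * ‖x‖ := by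
  let b := Module.finBasis 𝕜 K
  obtain ⟨C, hC, hle⟩ := b.exists_opNorm_le (F := F)
  have hsmall : ∀ᶠ n in l, ∀ i, ‖T n (b i) - T₀ (b i)‖ < ε / C := by
    refine eventually_all.2 fun i => Tendsto.eventually_lt_const (v := 0) (div_pos hε hC) ?_
    simpa using (tendsto_sub_nhds_zero_iff.2 (hT _ (b i).2)).norm
  filter_upwards [hsmall] with n hn x hx
  let S : K →L[𝕜] F := ((T n - T₀).domRestrict K).toContinuousLinearMap
  have hS : ‖S‖ ≤ ε := by
    simpa only [mul_div_cancel₀ ε hC.ne'] using hle (div_pos hε hC).le fun i => (hn i).le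
  exact S.le_of_opNorm_le hS ⟨x, hx⟩

theorem mem_uniformLimit_of_forall_eventually {S : ℕ → Set ℂ} {a : ℂ}
    (h : ∀ ε > 0, ∀ᶠ n in atTop, ∃ z ∈ S n, dist z a ≤ ε) : a ∈ uniformLimit S := by
  have hclose : ∀ n : ℕ, ∃ w, ∀ z ∈ S n, w ∈ S n ∧ dist a w < dist a z + 1 / ((n : ℝ) + 1) := by
    intro n
    rcases (S n).eq_empty_or_nonempty with hempty | hne
    · exact ⟨0, fun z hz => absurd hz (hempty ▸ Set.notMem_empty z)⟩
    · obtain ⟨w, hw, hlt⟩ := (Metric.infDist_lt_iff hne).1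
        (lt_add_of_pos_right (Metric.infDist a (S n)) Nat.one_div_pos_of_nat)
      exact ⟨w, fun z hz => ⟨hw, hlt.trans_le (by gcongr; exact Metric.infDist_le_dist_of_mem hz)⟩⟩
  choose w hw using hclose
  refine ⟨w, ?_, Metric.tendsto_nhds.2 fun ε hε => ?_⟩
  · filter_upwards [h 1 one_pos] with n ⟨z, hz, _⟩ using (hw n z hz).1
  · filter_upwards [h (ε / 2) (half_pos hε),
      tendsto_one_div_add_atTop_nhds_zero_nat.eventually_lt_const (half_pos hε)]
      with n ⟨z, hz, hza⟩ hn
    have hlt := (hw n z hz).2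
    rw [dist_comm] at hza ⊢
    linarith

section InnerProduct

variable {𝕜 E : Type*} [RCLike 𝕜] [NormedAddCommGroup E] [InnerProductSpace 𝕜 E]

theorem norm_mul_sq_norm_starProjection_le (K : Submodule 𝕜 E) [K.HasOrthogonalProjection]
    (c : 𝕜) (v y : E) :
    ‖c‖ * ‖K.starProjection v‖ ^ 2 ≤ ‖inner 𝕜 v y‖ + ‖v‖ * ‖y - c • K.starProjection v‖ := by
  have hproj : inner 𝕜 v (K.starProjection v) = (‖K.starProjection v‖ : 𝕜) ^ 2 := by
    rw [← inner_self_eq_norm_sq_to_K, ← sub_eq_zero, ← inner_sub_left]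
    exact K.starProjection_inner_eq_zero v _ (K.starProjection_apply_mem v)
  have hsplit : c * (‖K.starProjection v‖ : 𝕜) ^ 2 =
      inner 𝕜 v y - inner 𝕜 v (y - c • K.starProjection v) := by
    rw [inner_sub_right, inner_smul_right, hproj, sub_sub_cancel]
  calc ‖c‖ * ‖K.starProjection v‖ ^ 2 = ‖c * (‖K.starProjection v‖ : 𝕜) ^ 2‖ := by simp
    _ ≤ ‖inner 𝕜 v y‖ + ‖inner 𝕜 v (y - c • K.starProjection v)‖ := hsplit ▸ norm_sub_le _ _
    _ ≤ ‖inner 𝕜 v y‖ + ‖v‖ * ‖y - c • K.starProjection v‖ := by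
        gcongr
        exact norm_inner_le_norm _ _

theorem sq_norm_le_norm_inner_add_add (b x y : E) :
    ‖b‖ ^ 2 ≤ ‖inner 𝕜 (b + x) (b + y)‖ + (‖b‖ * (‖x‖ + ‖y‖) + ‖x‖ * ‖y‖) := by
  have hsplit : (‖b‖ : 𝕜) ^ 2 = inner 𝕜 (b + x) (b + y) - inner 𝕜 b y - inner 𝕜 x b -
      inner 𝕜 x y := by
    rw [← inner_self_eq_norm_sq_to_K, inner_add_left, inner_add_right, inner_add_right]
    ring
  calc ‖b‖ ^ 2 = ‖(‖b‖ : 𝕜) ^ 2‖ := by simp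
    _ ≤ ‖inner 𝕜 (b + x) (b + y)‖ + ‖inner 𝕜 b y‖ + ‖inner 𝕜 x b‖ + ‖inner 𝕜 x y‖ := by
        rw [hsplit]
        refine (norm_sub_le _ _).trans ?_
        gcongr
        refine (norm_sub_le _ _).trans ?_
        gcongr
        exact norm_sub_le _ _
    _ ≤ ‖inner 𝕜 (b + x) (b + y)‖ + ‖b‖ * ‖y‖ + ‖x‖ * ‖b‖ + ‖x‖ * ‖y‖ := by
        gcongr <;> exact norm_inner_le_norm _ _
    _ = ‖inner 𝕜 (b + x) (b + y)‖ + (‖b‖ * (‖x‖ + ‖y‖) + ‖x‖ * ‖y‖) := by ring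

end InnerProduct

section Resolvent

variable {H : Type*} [NormedAddCommGroup H] [InnerProductSpace ℂ H] {M : H →ₗ.[ℂ] H} {lam μ z : ℂ}
  {R S : H →L[ℂ] H}

/-- `R` is the resolvent `(M - z)⁻¹`, the operator whose existence puts `z` outside `spec M`. The
identities `(M - z) R = 1` and `R (M - z) = 1` are stated without subtraction, as rewriting rules
for `M R` and `R M`. -/
structure IsResolvent (M : H →ₗ.[ℂ] H) (z : ℂ) (R : H →L[ℂ] H) : Prop where
  mem_domain (y : H) : R y ∈ M.domain
  map_apply (y : H) : M ⟨R y, mem_domain y⟩ = y + z • R y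
  apply_map (x : M.domain) : R (M x) = x + z • R x

theorem exists_isResolvent_of_notMem_spec (hz : z ∉ spec M) : ∃ R, IsResolvent M z R := by
  obtain ⟨R, hright, hleft⟩ := not_not.1 hz
  refine ⟨R, fun y => (hright y).1, fun y => sub_eq_iff_eq_add.1 (hright y).2, fun x => ?_⟩
  rw [← sub_eq_iff_eq_add, ← map_smul, ← map_sub]
  exact hleft x

theorem mem_eigenspace_iff {ψ : H} :
    ψ ∈ eigenspace M lam ↔ ∃ h : ψ ∈ M.domain, M ⟨ψ, h⟩ = lam • ψ := by
  constructor
  · rintro ⟨x, hx, rfl⟩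
    exact ⟨x.2, sub_eq_zero.1 hx⟩
  · rintro ⟨h, hψ⟩
    exact ⟨⟨ψ, h⟩, sub_eq_zero.2 hψ, rfl⟩

namespace IsResolvent

theorem sub_smul_mul (hR : IsResolvent M μ R) (hS : IsResolvent M z S) :
    (z - μ) • (R * S) = S - R := by
  ext y
  have h : R y + z • R (S y) = S y + μ • R (S y) := by
    rw [← map_smul, ← map_add, ← hS.map_apply y]
    exact hR.apply_map ⟨S y, hS.mem_domain y⟩
  calc (z - μ) • R (S y) = (R y + z • R (S y)) - μ • R (S y) - R y := by module
    _ = S y - R y := by rw [h, add_sub_cancel_right]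

theorem inv_sub_notMem_spectrum (hR : IsResolvent M μ R) (hz : z ∉ spec M) (hne : z ≠ μ) :
    (z - μ)⁻¹ ∉ spectrum ℂ R := by
  obtain ⟨S, hS⟩ := exists_isResolvent_of_notMem_spec hz
  have hc : z - μ ≠ 0 := sub_ne_zero.2 hne
  have hRS : (z - μ) • (R * S) = S - R := hR.sub_smul_mul hS
  have hSR : (z - μ) • (S * R) = S - R := by
    rw [← neg_sub R S, ← hS.sub_smul_mul hR, ← neg_smul, neg_sub]
  have hscale : (z - μ) • ((z - μ)⁻¹ • 1 - R) = 1 - (z - μ) • R := by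
    rw [smul_sub, smul_inv_smul₀ hc]
  rw [spectrum.notMem_iff, Algebra.algebraMap_eq_smul_one, isUnit_iff_exists]
  refine ⟨(z - μ) • (1 + (z - μ) • S), ?_, ?_⟩
  · rw [mul_smul_comm, ← smul_mul_assoc, hscale]
    simp only [sub_mul, mul_add, one_mul, mul_one, smul_mul_assoc, mul_smul_comm, hRS]
    module
  · rw [smul_mul_assoc, ← mul_smul_comm, hscale]
    simp only [mul_sub, add_mul, one_mul, mul_one, smul_mul_assoc, mul_smul_comm, hSR]
    module

theorem eventually_notMem_spectrum (hR : IsResolvent M μ R) (hne : lam ≠ μ)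
    (hiso : ∀ᶠ w in 𝓝[≠] lam, w ∉ spec M) :
    ∀ᶠ w in 𝓝[≠] (lam - μ)⁻¹, w ∉ spectrum ℂ R := by
  have hinv : (lam - μ)⁻¹ ≠ 0 := inv_ne_zero (sub_ne_zero.2 hne)
  have hnhds : Tendsto (fun w => μ + w⁻¹) (𝓝 (lam - μ)⁻¹) (𝓝 lam) := by
    simpa using (tendsto_inv₀ hinv).const_add μ
  have hpunctured : Tendsto (fun w => μ + w⁻¹) (𝓝[≠] (lam - μ)⁻¹) (𝓝[≠] lam) := by
    refine tendsto_nhdsWithin_iff.2 ⟨hnhds.mono_left nhdsWithin_le_nhds, ?_⟩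
    filter_upwards [self_mem_nhdsWithin] with w hw heq
    rw [← heq, add_sub_cancel_left, inv_inv] at hw
    exact hw rfl
  filter_upwards [hpunctured.eventually hiso,
    (eventually_ne_nhds hinv).filter_mono nhdsWithin_le_nhds] with w hw hw0
  simpa using hR.inv_sub_notMem_spectrum hw (by simpa using hw0)

theorem apply_map_sub_smul (hR : IsResolvent M μ R) (x : M.domain) :
    R (M x - lam • (x : H)) = x - (lam - μ) • R x := by
  rw [map_sub, map_smul, hR.apply_map]
  module

theorem eigenspace_le (hR : IsResolvent M μ R) (hne : lam ≠ μ) :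
    Module.End.eigenspace (R : H →ₗ[ℂ] H) (lam - μ)⁻¹ ≤ eigenspace M lam := by
  intro u hu
  have hc : lam - μ ≠ 0 := sub_ne_zero.2 hne
  have hRu : R u = (lam - μ)⁻¹ • u := Module.End.mem_eigenspace_iff.1 hu
  have hu_eq : u = (lam - μ) • R u := by rw [hRu, smul_inv_smul₀ hc]
  have hdom : u ∈ M.domain := hu_eq ▸ M.domain.smul_mem _ (hR.mem_domain u)
  refine mem_eigenspace_iff.2 ⟨hdom, ?_⟩
  calc M ⟨u, hdom⟩ = M ((lam - μ) • ⟨R u, hR.mem_domain u⟩) := congrArg M (Subtype.ext hu_eq)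
    _ = (lam - μ) • u + μ • ((lam - μ) • R u) := by
      rw [M.map_smul, hR.map_apply, smul_add, smul_comm]
    _ = lam • u := by
      rw [← hu_eq]
      module

theorem isSelfAdjoint [CompleteSpace H] (hM : M.IsFormalAdjoint M)
    (hμ : starRingEnd ℂ μ = μ) (hR : IsResolvent M μ R) : IsSelfAdjoint R := by
  rw [ContinuousLinearMap.isSelfAdjoint_iff_isSymmetric]
  intro x y
  have h := hM ⟨R x, hR.mem_domain x⟩ ⟨R y, hR.mem_domain y⟩
  simp only [hR.map_apply, inner_add_left, inner_add_right, inner_smul_left, inner_smul_right, hμ,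
    add_left_inj] at h
  exact h.symm

end IsResolvent

theorem isFormalAdjoint_self [CompleteSpace H] (hM : IsSelfAdjoint M) : M.IsFormalAdjoint M := by
  have h := LinearPMap.adjoint_isFormalAdjoint hM.dense_domain
  rwa [LinearPMap.isSelfAdjoint_def.1 hM] at h

theorem conj_eq_of_eigenspace_ne_bot (hM : M.IsFormalAdjoint M) (h : eigenspace M lam ≠ ⊥) :
    starRingEnd ℂ lam = lam := by
  obtain ⟨ψ, hψ, hψ0⟩ := Submodule.exists_mem_ne_zero_of_ne_bot h
  obtain ⟨hdom, heq⟩ := mem_eigenspace_iff.1 hψ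
  have hinner := hM ⟨ψ, hdom⟩ ⟨ψ, hdom⟩
  rw [heq, inner_smul_left, inner_smul_right] at hinner
  exact mul_right_cancel₀ (inner_self_ne_zero.2 hψ0) hinner

theorem exists_conj_eq_notMem_spec (hlam : starRingEnd ℂ lam = lam)
    (hiso : ∀ᶠ w in 𝓝[≠] lam, w ∉ spec M) :
    ∃ μ : ℂ, starRingEnd ℂ μ = μ ∧ lam ≠ μ ∧ μ ∉ spec M := by
  have hline : Tendsto (fun t : ℝ => lam + t) (𝓝[≠] 0) (𝓝[≠] lam) := by
    refine tendsto_nhdsWithin_iff.2 ⟨?_, ?_⟩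
    · have : Continuous fun t : ℝ => lam + t := by fun_prop
      simpa using this.continuousAt.tendsto.mono_left (nhdsWithin_le_nhds (a := (0 : ℝ)))
    · filter_upwards [self_mem_nhdsWithin] with t ht
      simpa using ht
  obtain ⟨t, ht, ht0⟩ := ((hline.eventually hiso).and self_mem_nhdsWithin).exists
  exact ⟨lam + t, by rw [map_add, hlam, Complex.conj_ofReal], by simpa using ht0, ht⟩

theorem exists_norm_le_mul_norm_sub_smul [CompleteSpace H] (hM : M.IsFormalAdjoint M)
    (hlam : starRingEnd ℂ lam = lam) (hiso : ∀ᶠ w in 𝓝[≠] lam, w ∉ spec M) :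
    ∃ C : ℝ, ∀ v : M.domain, (v : H) ∈ (eigenspace M lam)ᗮ →
      ‖(v : H)‖ ≤ C * ‖M v - lam • (v : H)‖ := by
  obtain ⟨μ, hμ, hne, hspec⟩ := exists_conj_eq_notMem_spec hlam hiso
  obtain ⟨R, hR⟩ := exists_isResolvent_of_notMem_spec hspec
  have hnormal : IsStarNormal R := (hR.isSelfAdjoint hM hμ).isStarNormal
  obtain ⟨C, hC, hle⟩ :=
    exists_norm_le_mul_norm_sub_smul_of_isolated (hR.eventually_notMem_spectrum hne hiso)
  refine ⟨C * (‖(lam - μ)⁻¹‖ * ‖R‖), fun v hv => ?_⟩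
  have hsub : R v - (lam - μ)⁻¹ • (v : H) = -((lam - μ)⁻¹ • R (M v - lam • (v : H))) := by
    rw [hR.apply_map_sub_smul, smul_sub, inv_smul_smul₀ (sub_ne_zero.2 hne), neg_sub]
  calc ‖(v : H)‖ ≤ C * ‖R v - (lam - μ)⁻¹ • (v : H)‖ :=
        hle v (Submodule.orthogonal_le (hR.eigenspace_le hne) hv)
    _ = C * (‖(lam - μ)⁻¹‖ * ‖R (M v - lam • (v : H))‖) := by rw [hsub, norm_neg, norm_smul]
    _ ≤ C * (‖(lam - μ)⁻¹‖ * (‖R‖ * ‖M v - lam • (v : H)‖)) := by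
        gcongr
        exact R.le_opNorm _
    _ = C * (‖(lam - μ)⁻¹‖ * ‖R‖) * ‖M v - lam • (v : H)‖ := by ring

theorem norm_sub_starProjection_le {C : ℝ} [(eigenspace M lam).HasOrthogonalProjection]
    (hC : ∀ v : M.domain, (v : H) ∈ (eigenspace M lam)ᗮ → ‖(v : H)‖ ≤ C * ‖M v - lam • (v : H)‖)
    (v : M.domain) :
    ‖(v : H) - (eigenspace M lam).starProjection v‖ ≤ C * ‖M v - lam • (v : H)‖ := by
  obtain ⟨hdom, heq⟩ := mem_eigenspace_iff.1 ((eigenspace M lam).starProjection_apply_mem (v : H))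
  have hle := hC (v - ⟨_, hdom⟩) ((eigenspace M lam).sub_starProjection_mem_orthogonal (v : H))
  rw [M.map_sub, heq] at hle
  refine hle.trans_eq ?_
  congr 2
  simp only [AddSubgroupClass.coe_sub]
  module

end Resolvent

noncomputable section Pencil

variable {H : Type*} [NormedAddCommGroup H] [InnerProductSpace ℂ H] {M : H →ₗ.[ℂ] H} {lam z : ℂ}

/-- The compression `P T P : H → H` of `T` to `L`, which is what condition (H) controls. -/
def compression (T : H →ₗ.[ℂ] H) (L : Submodule ℂ H) [L.HasOrthogonalProjection]
    (hL : L ≤ T.domain) : H →ₗ[ℂ] H :=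
  L.subtype ∘ₗ truncation T L hL ∘ₗ L.orthogonalProjectionOnto.toLinearMap

/-- The quadratic pencil `z ↦ P (M - z)²|L`, whose singular points form `spec₂ M L hL`. It takes
values in the continuous endomorphisms of `L`, so that it can be differentiated in `z`. -/
def pencil (M : H →ₗ.[ℂ] H) (L : Submodule ℂ H) [FiniteDimensional ℂ L]
    (hL : L ≤ (sq M).domain) (z : ℂ) : L →L[ℂ] L :=
  LinearMap.toContinuousLinearMap
    (truncation (sq (shift M z)) L (hL.trans (sq_domain_le_sq_shift_domain M z)))

theorem sq_shift_apply (z : ℂ) (x : (sq M).domain) :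
    sq (shift M z) ⟨x, sq_domain_le_sq_shift_domain M z x.2⟩ =
      sq M x - (2 * z) • M ⟨x, x.2.1⟩ + z ^ 2 • (x : H) := by
  change M (⟨M ⟨x, x.2.1⟩, x.2.2⟩ - z • ⟨x, x.2.1⟩) - z • (M ⟨x, x.2.1⟩ - z • (x : H)) =
    M ⟨M ⟨x, x.2.1⟩, x.2.2⟩ - (2 * z) • M ⟨x, x.2.1⟩ + z ^ 2 • (x : H)
  rw [M.map_sub, M.map_smul]
  module

variable {L : Submodule ℂ H} [FiniteDimensional ℂ L] (hL : L ≤ (sq M).domain)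

theorem pencil_apply (z : ℂ) (v : L) :
    pencil M L hL z v = truncation (sq M) L hL v -
      (2 * z) • truncation M L (hL.trans (sq_domain_le M)) v + z ^ 2 • v := by
  have h := congrArg L.orthogonalProjectionOnto (sq_shift_apply z ⟨(v : H), hL v.2⟩)
  rw [map_add, map_sub, map_smul, map_smul,
    Submodule.orthogonalProjectionOnto_mem_subspace_eq_self] at h
  exact h

theorem differentiable_pencil : Differentiable ℂ (pencil M L hL) := by
  have h : pencil M L hL = fun z =>
      LinearMap.toContinuousLinearMap (truncation (sq M) L hL) -
        (2 * z) • LinearMap.toContinuousLinearMap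
          (truncation M L (hL.trans (sq_domain_le M))) + z ^ 2 • (1 : L →L[ℂ] L) := by
    funext z
    ext1 v
    exact pencil_apply hL z v
  rw [h]
  exact differentiable_quadratic (𝕜 := ℂ) (V := L →L[ℂ] L) _ _ _

theorem isUnit_pencil (hz : z ∉ spec₂ M L hL) : IsUnit (pencil M L hL z) :=
  ((LinearMap.isUnit_iff_isUnit_det _).2 (isUnit_iff_ne_zero.2 hz)).map
    (Module.End.toContinuousLinearMap L)

theorem inner_pencil_left (hM : M.IsFormalAdjoint M) (z : ℂ) (v w : L) :
    inner ℂ (pencil M L hL z v) w = inner ℂ (M ⟨v, (hL v.2).1⟩ - z • (v : H))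
      (M ⟨w, (hL w.2).1⟩ - starRingEnd ℂ z • (w : H)) := by
  let u : M.domain := ⟨M ⟨v, (hL v.2).1⟩, (hL v.2).2⟩ - z • ⟨v, (hL v.2).1⟩
  change inner ℂ (L.orthogonalProjectionOnto (M u - z • (u : H))) w = inner ℂ (u : H) _
  rw [Submodule.inner_orthogonalProjectionOnto_eq_of_mem_right, inner_sub_left, inner_smul_left,
    inner_sub_right, inner_smul_right, hM u ⟨w, (hL w.2).1⟩]

theorem inner_pencil_comm (hM : M.IsFormalAdjoint M) (z : ℂ) (v w : L) :
    inner ℂ (pencil M L hL z v) w = inner ℂ v (pencil M L hL (starRingEnd ℂ z) w) := by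
  rw [← inner_conj_symm v, inner_pencil_left hL hM, inner_pencil_left hL hM, inner_conj_symm,
    Complex.conj_conj]

theorem norm_mul_norm_starProjection_le_norm_pencil_add (hM : M.IsFormalAdjoint M)
    (K : Submodule ℂ H) [K.HasOrthogonalProjection] {c : ℂ} {ε : ℝ} (hε : 0 ≤ ε)
    (happrox : ∀ φ ∈ K, ‖(pencil M L hL (starRingEnd ℂ z) (L.orthogonalProjectionOnto φ) : H) -
      c • φ‖ ≤ ε * ‖φ‖) (v : L) :
    ‖c‖ * ‖K.starProjection (v : H)‖ ≤ ‖pencil M L hL z v‖ + ε * ‖v‖ := by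
  set φ := K.starProjection (v : H)
  let y : L := pencil M L hL (starRingEnd ℂ z) (L.orthogonalProjectionOnto φ)
  rcases (norm_nonneg φ).eq_or_lt with hφ | hφ
  · rw [← hφ, mul_zero]
    positivity
  have hinner : ‖inner ℂ (v : H) (y : H)‖ ≤ ‖pencil M L hL z v‖ * ‖φ‖ :=
    calc ‖inner ℂ v y‖ = ‖inner ℂ (pencil M L hL z v) (L.orthogonalProjectionOnto φ)‖ := by
          rw [inner_pencil_comm hL hM]
      _ ≤ ‖pencil M L hL z v‖ * ‖L.orthogonalProjectionOnto φ‖ := norm_inner_le_norm _ _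
      _ ≤ ‖pencil M L hL z v‖ * ‖φ‖ := by
          gcongr
          exact L.norm_orthogonalProjectionOnto_apply_le φ
  refine le_of_mul_le_mul_right ?_ hφ
  calc ‖c‖ * ‖φ‖ * ‖φ‖ = ‖c‖ * ‖φ‖ ^ 2 := by ring
    _ ≤ ‖inner ℂ (v : H) (y : H)‖ + ‖(v : H)‖ * ‖(y : H) - c • φ‖ :=
        norm_mul_sq_norm_starProjection_le K c _ _
    _ ≤ ‖pencil M L hL z v‖ * ‖φ‖ + ‖v‖ * (ε * ‖φ‖) := by
        gcongr
        · exact le_rfl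
        · exact happrox φ (K.starProjection_apply_mem _)
    _ = (‖pencil M L hL z v‖ + ε * ‖v‖) * ‖φ‖ := by ring

theorem norm_conj_sub (hlam : starRingEnd ℂ lam = lam) :
    ‖starRingEnd ℂ z - lam‖ = ‖z - lam‖ := by
  rw [← Complex.norm_conj (z - lam), map_sub, hlam]

theorem sq_norm_map_sub_smul_le_norm_pencil_mul_add (hM : M.IsFormalAdjoint M)
    (hlam : starRingEnd ℂ lam = lam) (v : L) :
    ‖M ⟨v, (hL v.2).1⟩ - lam • (v : H)‖ ^ 2 ≤ ‖pencil M L hL z v‖ * ‖v‖ +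
      (2 * ‖z - lam‖ * ‖M ⟨v, (hL v.2).1⟩ - lam • (v : H)‖ * ‖v‖ + ‖z - lam‖ ^ 2 * ‖v‖ ^ 2) := by
  set b : H := M ⟨v, (hL v.2).1⟩ - lam • (v : H) with hb
  have hz (w : ℂ) : M ⟨v, (hL v.2).1⟩ - w • (v : H) = b + -((w - lam) • (v : H)) := by
    rw [hb]
    module
  have hinner : ‖inner ℂ (b + -((z - lam) • (v : H)))
      (b + -((starRingEnd ℂ z - lam) • (v : H)))‖ ≤ ‖pencil M L hL z v‖ * ‖v‖ := by
    rw [← hz, ← hz, ← inner_pencil_left hL hM]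
    exact norm_inner_le_norm _ _
  have h := sq_norm_le_norm_inner_add_add (𝕜 := ℂ) b (-((z - lam) • (v : H)))
    (-((starRingEnd ℂ z - lam) • (v : H)))
  rw [norm_neg, norm_neg, norm_smul, norm_smul, norm_conj_sub hlam, ← Submodule.coe_norm] at h
  linarith

theorem mul_norm_le_norm_pencil_of_mem_sphere (hM : M.IsFormalAdjoint M)
    (hlam : starRingEnd ℂ lam = lam) [(eigenspace M lam).HasOrthogonalProjection] {C r : ℝ}
    (hC : ∀ v : M.domain, (v : H) ∈ (eigenspace M lam)ᗮ → ‖(v : H)‖ ≤ C * ‖M v - lam • (v : H)‖)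
    (hr : 0 < r) (hrC : 6 * r * C ≤ 1)
    (happrox : ∀ φ ∈ eigenspace M lam, ∀ z ∈ Metric.sphere lam r,
      ‖(pencil M L hL z (L.orthogonalProjectionOnto φ) : H) - (lam - z) ^ 2 • φ‖ ≤
        r ^ 2 / 8 * ‖φ‖)
    (hz : z ∈ Metric.sphere lam r) (v : L) : r ^ 2 / 4 * ‖v‖ ≤ ‖pencil M L hL z v‖ := by
  rw [mem_sphere_iff_norm] at hz
  have hconj : ‖starRingEnd ℂ z - lam‖ = r := (norm_conj_sub hlam).trans hz
  set φ : H := (eigenspace M lam).starProjection (v : H)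
  set b : H := M ⟨v, (hL v.2).1⟩ - lam • (v : H)
  rcases le_or_gt ‖v‖ (2 * ‖φ‖) with hnear | hfar
  · have hlower : ‖(lam - starRingEnd ℂ z) ^ 2‖ * ‖φ‖ ≤ ‖pencil M L hL z v‖ + r ^ 2 / 8 * ‖v‖ :=
      norm_mul_norm_starProjection_le_norm_pencil_add hL hM (eigenspace M lam) (by positivity)
        (fun φ hφ => happrox φ hφ _ (mem_sphere_iff_norm.2 hconj)) v
    rw [norm_pow, norm_sub_rev, hconj] at hlower
    have := mul_le_mul_of_nonneg_left hnear (sq_nonneg r)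
    have : 0 ≤ r ^ 2 * ‖v‖ := by positivity
    linarith
  · have hv : 0 < ‖v‖ := (by positivity : 0 ≤ 2 * ‖φ‖).trans_lt hfar
    have hgap : ‖(v : H) - φ‖ ≤ C * ‖b‖ := norm_sub_starProjection_le hC ⟨v, (hL v.2).1⟩
    have htri : ‖v‖ - ‖φ‖ ≤ ‖(v : H) - φ‖ := norm_sub_norm_le (v : H) φ
    have hb : 3 * r * ‖v‖ ≤ ‖b‖ :=
      calc 3 * r * ‖v‖ ≤ 6 * r * (C * ‖b‖) := by
            rw [show 3 * r * ‖v‖ = 6 * r * (‖v‖ / 2) by ring]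
            gcongr
            linarith
        _ = 6 * r * C * ‖b‖ := by ring
        _ ≤ ‖b‖ := mul_le_of_le_one_left (norm_nonneg b) hrC
    have hsq := sq_norm_map_sub_smul_le_norm_pencil_mul_add hL (z := z) hM hlam v
    rw [hz] at hsq
    have : (2 * r * ‖v‖) ^ 2 ≤ (‖b‖ - r * ‖v‖) ^ 2 := by
      gcongr
      linarith
    have : 0 ≤ r ^ 2 * ‖v‖ ^ 2 := by positivity
    refine le_of_mul_le_mul_right ?_ hv
    linarith

theorem exists_mem_spec₂_dist_le (hM : M.IsFormalAdjoint M)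
    (hlam : starRingEnd ℂ lam = lam) [(eigenspace M lam).HasOrthogonalProjection] {C r : ℝ}
    (hC : ∀ v : M.domain, (v : H) ∈ (eigenspace M lam)ᗮ → ‖(v : H)‖ ≤ C * ‖M v - lam • (v : H)‖)
    (hr : 0 < r) (hrC : 6 * r * C ≤ 1)
    (happrox : ∀ φ ∈ eigenspace M lam, ∀ z ∈ Metric.closedBall lam r,
      ‖(pencil M L hL z (L.orthogonalProjectionOnto φ) : H) - (lam - z) ^ 2 • φ‖ ≤
        r ^ 2 / 8 * ‖φ‖)
    {ψ : H} (hψ : ψ ∈ eigenspace M lam) (hψL : ‖ψ‖ < 2 * ‖L.orthogonalProjectionOnto ψ‖) :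
    ∃ z ∈ spec₂ M L hL, dist z lam ≤ r := by
  by_contra! hno
  have hlower : r ^ 2 / 4 * ‖L.orthogonalProjectionOnto ψ‖ ≤
      ‖pencil M L hL lam (L.orthogonalProjectionOnto ψ)‖ :=
    mul_norm_le_norm_apply_of_forall_frontier Metric.isBounded_ball
      (differentiable_pencil hL).diffContOnCl
      (fun z hz => isUnit_pencil hL fun hmem =>
        (hno z hmem).not_ge (Metric.closure_ball_subset_closedBall hz))
      (by positivity)
      (fun z hz => mul_norm_le_norm_pencil_of_mem_sphere hL hM hlam hC hr hrC
        (fun φ hφ w hw => happrox φ hφ w (Metric.sphere_subset_closedBall hw))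
        (Metric.frontier_ball_subset_sphere hz))
      (subset_closure (Metric.mem_ball_self hr)) _
  have hupper : ‖pencil M L hL lam (L.orthogonalProjectionOnto ψ)‖ ≤ r ^ 2 / 8 * ‖ψ‖ := by
    simpa using happrox ψ hψ lam (Metric.mem_closedBall_self hr.le)
  have := mul_lt_mul_of_pos_left hψL (by positivity : 0 < r ^ 2 / 8)
  linarith

theorem pencil_orthogonalProjectionOnto_sub (z : ℂ) (φ : H) :
    (pencil M L hL z (L.orthogonalProjectionOnto φ) : H) - (lam - z) ^ 2 • φ =
      (compression (sq M) L hL φ - lam ^ 2 • φ) -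
        (2 * z) • (compression M L (hL.trans (sq_domain_le M)) φ - lam • φ) +
        z ^ 2 • (L.starProjection φ - φ) := by
  have h : (pencil M L hL z (L.orthogonalProjectionOnto φ) : H) = compression (sq M) L hL φ -
      (2 * z) • compression M L (hL.trans (sq_domain_le M)) φ + z ^ 2 • L.starProjection φ :=
    congrArg Subtype.val (pencil_apply hL z (L.orthogonalProjectionOnto φ))
  rw [h]
  module

theorem norm_pencil_sub_le {K η : ℝ} (hz : ‖z‖ ≤ K) {φ : H}
    (h₂ : ‖compression (sq M) L hL φ - lam ^ 2 • φ‖ ≤ η)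
    (h₁ : ‖compression M L (hL.trans (sq_domain_le M)) φ - lam • φ‖ ≤ η)
    (h₀ : ‖L.starProjection φ - φ‖ ≤ η) :
    ‖(pencil M L hL z (L.orthogonalProjectionOnto φ) : H) - (lam - z) ^ 2 • φ‖ ≤
      (1 + K) ^ 2 * η := by
  rw [pencil_orthogonalProjectionOnto_sub]
  have hK : 0 ≤ K := (norm_nonneg z).trans hz
  calc _ ≤ ‖compression (sq M) L hL φ - lam ^ 2 • φ‖ +
        ‖(2 * z) • (compression M L (hL.trans (sq_domain_le M)) φ - lam • φ)‖ +
        ‖z ^ 2 • (L.starProjection φ - φ)‖ :=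
        (norm_add_le _ _).trans (by gcongr; exact norm_sub_le _ _)
    _ ≤ η + 2 * K * η + K ^ 2 * η := by
        rw [norm_smul, norm_smul, norm_mul, norm_pow, Complex.norm_ofNat]
        gcongr
    _ = (1 + K) ^ 2 * η := by ring

theorem eventually_forall_norm_pencil_sub_le {L : ℕ → Submodule ℂ H}
    [∀ n, FiniteDimensional ℂ (L n)] {hL : ∀ n, L n ≤ (sq M).domain}
    [FiniteDimensional ℂ (eigenspace M lam)]
    (hP : ∀ ψ ∈ eigenspace M lam, Tendsto (fun n => (L n).starProjection ψ) atTop (𝓝 ψ))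
    (hH : ConditionH M lam L hL) {s : Set ℂ} (hs : Bornology.IsBounded s) {ε : ℝ} (hε : 0 < ε) :
    ∀ᶠ n in atTop, ∀ φ ∈ eigenspace M lam, ∀ z ∈ s,
      ‖(pencil M (L n) (hL n) z ((L n).orthogonalProjectionOnto φ) : H) - (lam - z) ^ 2 • φ‖ ≤
        ε * ‖φ‖ := by
  obtain ⟨K, hK, hle⟩ := hs.exists_pos_norm_le
  have hη : 0 < ε / (1 + K) ^ 2 := by positivity
  have hM₁ : ∀ ψ ∈ eigenspace M lam,
      Tendsto (fun n => compression M (L n) ((hL n).trans (sq_domain_le M)) ψ) atTop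
        (𝓝 ((lam • LinearMap.id : H →ₗ[ℂ] H) ψ)) := fun ψ hψ => (hH ψ hψ).1
  have hM₂ : ∀ ψ ∈ eigenspace M lam, Tendsto (fun n => compression (sq M) (L n) (hL n) ψ) atTop
      (𝓝 ((lam ^ 2 • LinearMap.id : H →ₗ[ℂ] H) ψ)) := fun ψ hψ => (hH ψ hψ).2
  have hP₀ : ∀ ψ ∈ eigenspace M lam, Tendsto (fun n => (L n).starProjection.toLinearMap ψ) atTop
      (𝓝 ((LinearMap.id : H →ₗ[ℂ] H) ψ)) := hP
  filter_upwards [eventually_forall_norm_sub_le_of_tendsto _ hM₁ hη,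
    eventually_forall_norm_sub_le_of_tendsto _ hM₂ hη,
    eventually_forall_norm_sub_le_of_tendsto _ hP₀ hη] with n h₁ h₂ h₀ φ hφ z hz
  refine (norm_pencil_sub_le (hL n) (hle z hz) (h₂ φ hφ) (h₁ φ hφ) (h₀ φ hφ)).trans_eq ?_
  field_simp

end Pencil

end SecondOrder

open SecondOrder in
theorem theorem1_general {H : Type*} [NormedAddCommGroup H] [InnerProductSpace ℂ H]
    {M : H →ₗ.[ℂ] H} (hM : M.IsFormalAdjoint M)
    {L : ℕ → Submodule ℂ H} [∀ n, FiniteDimensional ℂ (L n)] {hL : ∀ n, L n ≤ (sq M).domain}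
    {lam : ℂ} (hne : eigenspace M lam ≠ ⊥) [FiniteDimensional ℂ (eigenspace M lam)]
    (hP : ∀ ψ ∈ eigenspace M lam, Tendsto (fun n => (L n).starProjection ψ) atTop (𝓝 ψ))
    {C : ℝ}
    (hC : ∀ v : M.domain, (v : H) ∈ (eigenspace M lam)ᗮ → ‖(v : H)‖ ≤ C * ‖M v - lam • (v : H)‖)
    (hH : ConditionH M lam L hL) :
    lam ∈ uniformLimit fun n => spec₂ M (L n) (hL n) := by
  have hlam := conj_eq_of_eigenspace_ne_bot hM hne
  obtain ⟨ψ, hψ, hψ0⟩ := Submodule.exists_mem_ne_zero_of_ne_bot hne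
  have hψL : ∀ᶠ n in atTop, ‖ψ‖ < 2 * ‖(L n).orthogonalProjectionOnto ψ‖ :=
    ((hP ψ hψ).norm.const_mul 2).eventually_const_lt (by linarith [norm_pos_iff.2 hψ0])
  refine mem_uniformLimit_of_forall_eventually fun ε hε => ?_
  obtain ⟨r, hr, hrC, hrε⟩ : ∃ r : ℝ, 0 < r ∧ 6 * r * C ≤ 1 ∧ r ≤ ε := by
    have hcont : Continuous fun r : ℝ => 6 * r * C := by fun_prop
    have hlim : Tendsto (fun r : ℝ => 6 * r * C) (𝓝[>] 0) (𝓝 0) :=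
      (hcont.tendsto' 0 0 (by simp)).mono_left nhdsWithin_le_nhds
    obtain ⟨r, hrC, hr, hrε⟩ :=
      ((hlim.eventually_lt_const one_pos).and (Ioc_mem_nhdsGT hε)).exists
    exact ⟨r, hr, hrC.le, hrε⟩
  filter_upwards [hψL, eventually_forall_norm_pencil_sub_le hP hH Metric.isBounded_closedBall
    (by positivity : 0 < r ^ 2 / 8)] with n hψn happrox
  obtain ⟨z, hz, hdist⟩ :=
    exists_mem_spec₂_dist_le (hL n) hM hlam hC hr hrC happrox hψ hψn
  exact ⟨z, hz, hdist.trans hrε⟩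

theorem theorem1 {H : Type*} [NormedAddCommGroup H] [InnerProductSpace ℂ H] [CompleteSpace H]
    (M : H →ₗ.[ℂ] H) (hM : IsSelfAdjoint M)
    (L : ℕ → Submodule ℂ H) [∀ n, FiniteDimensional ℂ (L n)]
    (hL : ∀ n, L n ≤ (SecondOrder.sq M).domain)
    (hP : ∀ x : H, Tendsto (fun n => ((L n).orthogonalProjectionOnto x : H)) atTop (𝓝 x))
    (lam : ℂ) (hlam : SecondOrder.IsIsolatedEigenvalueFiniteMult M lam)
    (hH : SecondOrder.ConditionH M lam L hL) :
    lam ∈ SecondOrder.uniformLimit (fun n => SecondOrder.spec₂ M (L n) (hL n)) := by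
  open SecondOrder in
  have hs := isFormalAdjoint_self hM
  have := hlam.finite_mult
  obtain ⟨C, hC⟩ := exists_norm_le_mul_norm_sub_smul hs
    (conj_eq_of_eigenspace_ne_bot hs hlam.eigenvalue) hlam.isolated
  exact theorem1_general hs hlam.eigenvalue (fun ψ _ => hP ψ) hC hH
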